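/- A computer is a partial recursive function $C:\{0,1\}^*\rightharpoonup\{0,1\}^*$; let $\Xi$ be the set of all computers, let $\lambda$ be the empty string and write $x\otimes y$ for concatenation. For $C\in\Xi$ and $x\in\{0,1\}^*$ let $(C\xrightarrow{x})\in\Xi$ be the computer $s\mapsto C(x\otimes s)$, and write $C\xrightarrow{x}D$ if $D=(C\xrightarrow{x})$. A set $\Phi\subset\Xi$ is branching if for every $C\in\Phi$: $(C\xrightarrow{x\otimes y})\in\Phi$ implies $(C\xrightarrow{x})\in\Phi$, and $(C\xrightarrow{x})\in\Phi$ for some $x\ne\lambda$. For $C\in\Phi$ put $C^{-1}(\Phi)=\{x:(C\xrightarrow{x})\in\Phi\}$, and define path probabilities on this tree by $\mu_{C^{-1}(\Phi)}(\lambda)=1$ and, for a bit $b$ with $x\otimes b\in C^{-1}(\Phi)$, $\mu_{C^{-1}(\Phi)}(x\otimes b)=\tfrac12\mu_{C^{-1}(\Phi)}(x)$ if $x\otimes\bar b\in C^{-1}(\Phi)$ and $\mu_{C^{-1}(\Phi)}(x\otimes b)=\mu_{C^{-1}(\Phi)}(x)$ otherwise. For $C,D\in\Phi$ put $$\mu_C^{(n)}(D|\Phi)=\sum_{x\in\{0,1\}^n:\,C\xrightarrow{x}D}\mu_{C^{-1}(\Phi)}(x).$$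 Call $\Phi$ irreducible if for all $C,D\in\Phi$ there is $x$ with $C\xrightarrow{x}D$; aperiodic if $\gcd\{n\ge1:\mu_C^{(n)}(C|\Phi)>0\}=1$ for every $C\in\Phi$; and positive recurrent if it is branching, irreducible and aperiodic and every state of the Markov chain on $\Phi$ with transition matrix $(\mu_C^{(1)}(D|\Phi))_{C,D\in\Phi}$ is positive recurrent (return is almost sure and the mean return time is finite). Let $$\mu(D|\Phi)=\lim_{m\to\infty}\mu_X^{(m)}(D|\Phi)\qquad(D\in\Phi),$$ for any $X\in\Phi$. For $k\in\mathbb N$ let $[C]_k$ be the set of all $D\in\Xi$ with $C(x)=D(x)$ (both undefined, or both defined and equal) for all $x$ with $|x|\ge k$. Call $\Phi$ complete if $[C]_k\subset\Phi$ for all $C\in\Phi$ and $k\ge1$; in this case, for $C\in\Phi$, put $\mu([C]_k|\Phi)=\sum_{D\in[C]_k}\mu(D|\Phi)$. Let $\sigma$ be a permutation of $\{0,1\}^n$, of order $|\sigma|:=n$, such that $\sigma(x)$ and $x$ have different first bits for at least one $x\in\{0,1\}^n$. For a string $s$ let $\mathcal I_\sigma(s)$ be obtained by applying $\sigma$ to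 the last $n$ bits of $s$, with $\mathcal I_\sigma(s)=s$ if $|s|<n$; and let $\mathcal I_\sigma(C)\in\Xi$ be the computer $s\mapsto C(\mathcal I_\sigma(s))$. Theorem (Input Symmetry). Let $\Phi\subset\Xi$ be positive recurrent, complete, and closed with respect to $\mathcal I_\sigma$, i.e. $\mathcal I_\sigma(C)\in\Phi$ for every $C\in\Phi$. Then the limits $\mu(D|\Phi)$, $D\in\Phi$, exist and do not depend on $X\in\Phi$, and for every $k\ge|\sigma|$ and every $C\in\Phi$ the series defining $\mu([C]_k|\Phi)$ and $\mu([\mathcal I_\sigma(C)]_k|\Phi)$ converge and $$\mu([C]_k|\Phi)=\mu([\mathcal I_\sigma(C)]_k|\Phi).$$ -/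

import Mathlib

open Filter Topology

noncomputable section

/-- A computer is a partial recursive function from finite binary strings to finite binary
strings. -/
def Computer : Type := {f : List Bool →. List Bool // Partrec f}

namespace Computer

/-- `C.run x` is the output of `C` on `x`; it is `Part.none` if `C` does not halt on `x`. -/
def run (C : Computer) : List Bool →. List Bool := C.1

/-- `C` emulates `D` via `x`. -/
def Emulates (C : Computer) (x : List Bool) (D : Computer) : Prop :=
  ∀ s : List Bool, C.run (x ++ s) = D.run s

theorem emulated_partrec (C : Computer) (x : List Bool) :
    Partrec (fun s : List Bool => C.run (x ++ s)) :=
  C.2.comp (Primrec.list_append.comp (Primrec.const x) Primrec.id).to_comp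

/-- The computer that `C` emulates via `x`. -/
def emulated (C : Computer) (x : List Bool) : Computer :=
  ⟨fun s => C.run (x ++ s), C.emulated_partrec x⟩

theorem emulates_iff (C : Computer) (x : List Bool) (D : Computer) :
    C.Emulates x D ↔ C.emulated x = D := by
  constructor
  · intro h
    exact Subtype.ext (funext h)
  · rintro rfl s
    rfl

/-- The set of computers `Φ` is branching. -/
def IsBranching (Φ : Set Computer) : Prop :=
  ∀ C ∈ Φ,
    (∀ x y : List Bool, C.emulated (x ++ y) ∈ Φ → C.emulated x ∈ Φ) ∧
    (∃ x : List Bool, x ≠ [] ∧ C.emulated x ∈ Φ)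

/-- The `Φ`-tree of `C`. -/
def tree (Φ : Set Computer) (C : Computer) : Set (List Bool) :=
  {x | C.emulated x ∈ Φ}

open Classical in
/-- Path probability of the reversed string: the head of the list is the last bit of the path. -/
def pathProbRev (Φ : Set Computer) (C : Computer) : List Bool → ℝ
  | [] => 1
  | b :: r =>
      if r.reverse ++ [!b] ∈ tree Φ C then 1 / 2 * pathProbRev Φ C r else pathProbRev Φ C r

/-- The path probability of a string `x` in the `Φ`-tree of `C`: the probability that the random
walk on the tree, starting at the root, arrives at `x`. See `pathProb_nil` and `pathProb_concat`
for the defining recursion. (It is only used for `x` in the tree.) -/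
def pathProb (Φ : Set Computer) (C : Computer) (x : List Bool) : ℝ :=
  pathProbRev Φ C x.reverse

theorem pathProb_nil (Φ : Set Computer) (C : Computer) : pathProb Φ C [] = 1 := rfl

open Classical in
theorem pathProb_concat (Φ : Set Computer) (C : Computer) (x : List Bool) (b : Bool) :
    pathProb Φ C (x ++ [b]) =
      if x ++ [!b] ∈ tree Φ C then 1 / 2 * pathProb Φ C x else pathProb Φ C x := by
  simp [pathProb, pathProbRev]

open Classical in
/-- The `n`-step computer probability `μ_C^{(n)}(D|Φ)`. -/
def nStepProb (Φ : Set Computer) (C : Computer) (n : ℕ) (D : Computer) : ℝ :=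
  ∑ x : Fin n → Bool, if C.Emulates (List.ofFn x) D then pathProb Φ C (List.ofFn x) else 0

/-- The emulation matrix of `Φ`. -/
def emulationMatrix (Φ : Set Computer) : Φ → Φ → ℝ :=
  fun C D => nStepProb Φ C.1 1 D.1

end Computer

open Classical in
/-- For a Markov chain with transition matrix `P`, the probability that the chain started at `i`
visits `j` at time `n ≥ 1` and at none of the times `1, …, n - 1`. -/
def firstPassageProb {S : Type*} (P : S → S → ℝ) : ℕ → S → S → ℝ
  | 0, _, _ => 0
  | 1, i, j => P i j
  | n + 2, i, j => ∑' k : S, if k = j then 0 else P i k * firstPassageProb P (n + 1) k j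

/-- Every state of the Markov chain with transition matrix `P` is positive recurrent: the chain
started at the state returns to it almost surely, and the mean return time is finite. -/
def IsPositiveRecurrentChain {S : Type*} (P : S → S → ℝ) : Prop :=
  ∀ i : S, HasSum (fun n : ℕ => firstPassageProb P n i i) 1 ∧
    Summable (fun n : ℕ => (n : ℝ) * firstPassageProb P n i i)

namespace Computer

/-- Any two elements of `Φ` emulate each other. -/
def IsIrreducible (Φ : Set Computer) : Prop :=
  ∀ C ∈ Φ, ∀ D ∈ Φ, ∃ x : List Bool, C.Emulates x D

/-- Every `C ∈ Φ` has period one: the greatest common divisor of the `n ≥ 1` with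
`μ_C^{(n)}(C|Φ) > 0` is `1` (this fails if there is no such `n`). -/
def IsAperiodic (Φ : Set Computer) : Prop :=
  ∀ C ∈ Φ, ∀ d : ℕ, (∀ n : ℕ, 1 ≤ n → 0 < nStepProb Φ C n C → d ∣ n) → d = 1

/-- A positive recurrent set of computers; this includes that it is branching, irreducible and
aperiodic. -/
structure IsPositiveRecurrent (Φ : Set Computer) : Prop where
  branching : IsBranching Φ
  irreducible : IsIrreducible Φ
  aperiodic : IsAperiodic Φ
  recurrent : IsPositiveRecurrentChain (emulationMatrix Φ)

open Classical in
/-- The stationary computer probability `μ(D|Φ)`: the limit of `μ_C^{(n)}(D|Φ)` as `n → ∞`, when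
it exists for all `C ∈ Φ` and does not depend on `C` (and `0` otherwise). -/
def computerProb (Φ : Set Computer) (D : Computer) : ℝ :=
  if h : ∃ p : ℝ, ∀ C ∈ Φ, Tendsto (fun n : ℕ => nStepProb Φ C n D) atTop (𝓝 p) then h.choose
  else 0

/-- `k`-equivalence of computers. -/
def kSetoid (k : ℕ) : Setoid Computer where
  r C D := ∀ x : List Bool, k ≤ x.length → C.run x = D.run x
  iseqv := ⟨fun _ _ _ => rfl, fun h x hx => (h x hx).symm,
    fun h₁ h₂ x hx => (h₁ x hx).trans (h₂ x hx)⟩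

/-- The equivalence class `[C]_k`, as a set of computers. -/
def kClass (k : ℕ) (C : Computer) : Set Computer := {D | (kSetoid k).r C D}

/-- A complete set of computers. -/
def IsCompleteSet (Φ : Set Computer) : Prop :=
  ∀ C ∈ Φ, ∀ k : ℕ, 1 ≤ k → kClass k C ⊆ Φ

/-- The class probability `μ([C]_k|Φ)`. -/
def classProb (Φ : Set Computer) (k : ℕ) (C : Computer) : ℝ :=
  ∑' D : kClass k C, computerProb Φ D

end Computer

/-- The permutations of `{0,1}^n` that define input transformations: `σ` changes the first bit of
at least one string of length `n`. -/
def MovesFirstBit {n : ℕ} (σ : Equiv.Perm (Fin n → Bool)) : Prop :=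
  ∃ (hn : 0 < n) (x : Fin n → Bool), x ⟨0, hn⟩ ≠ σ x ⟨0, hn⟩

/-- The last `n` bits of the string `s` (used only if `n ≤ |s|`). -/
def lastBits (n : ℕ) (s : List Bool) : Fin n → Bool :=
  fun i => s.getD (s.length - n + i) false

/-- The string obtained from `s` by applying `σ` to the last `n` bits; it is `s` itself if
`|s| < n`. -/
def permuteLast {n : ℕ} (σ : Equiv.Perm (Fin n → Bool)) (s : List Bool) : List Bool :=
  if n ≤ s.length then s.take (s.length - n) ++ List.ofFn (σ (lastBits n s)) else s

theorem permuteLast_append {n : ℕ} (σ : Equiv.Perm (Fin n → Bool)) (s : List Bool)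
    (x : Fin n → Bool) : permuteLast σ (s ++ List.ofFn x) = s ++ List.ofFn (σ x) := by
  have h : lastBits n (s ++ List.ofFn x) = x := by
    funext i
    simp [lastBits, List.getD_eq_getElem?_getD]
  simp [permuteLast, h]

theorem permuteLast_of_lt {n : ℕ} (σ : Equiv.Perm (Fin n → Bool)) (s : List Bool)
    (hs : s.length < n) : permuteLast σ s = s := by
  simp [permuteLast, Nat.not_le.mpr hs]

theorem lastBits_primrec (n : ℕ) : Primrec (lastBits n) := by
  refine Primrec.fin_curry.2 ?_
  exact (Primrec.list_getD false).comp Primrec.fst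
    (Primrec.nat_add.comp
      (Primrec.nat_sub.comp (Primrec.list_length.comp Primrec.fst) (Primrec.const n))
      (Primrec.fin_val.comp Primrec.snd))

theorem permuteLast_primrec {n : ℕ} (σ : Equiv.Perm (Fin n → Bool)) :
    Primrec (permuteLast σ) := by
  unfold permuteLast
  refine Primrec.ite (Primrec.nat_le.comp (Primrec.const n) Primrec.list_length) ?_ Primrec.id
  refine Primrec.list_append.comp (Primrec.list_take.comp
    (Primrec.nat_sub.comp Primrec.list_length (Primrec.const n)) Primrec.id) ?_
  exact (Primrec.dom_finite (fun x : Fin n → Bool => List.ofFn (σ x))).comp (lastBits_primrec n)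

namespace Computer

/-- The transformed computer `s ↦ C(𝓘_σ(s))`. -/
def inputTransform {n : ℕ} (σ : Equiv.Perm (Fin n → Bool)) (C : Computer) : Computer :=
  ⟨fun s => C.run (permuteLast σ s), C.2.comp (permuteLast_primrec σ).to_comp⟩

/-- `Φ` is closed with respect to the transformation `T`. -/
def IsClosedUnder (Φ : Set Computer) (T : Computer → Computer) : Prop := T '' Φ ⊆ Φ

end Computer

end

open Computer

/-! Reading random bits in the `Φ`-tree is a Markov chain on `Φ`. Two ingredients give the symmetry.

Convergence to equilibrium: positive recurrence provides a stationary distribution `π` (normalized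
expected visits during one excursion), and irreducibility with aperiodicity makes `P^n h` converge
pointwise to the `π`-mean of `h` for every `h` with values in `[0, 1]`. With `h` the indicator of a
class, this gives the limit of the probability of hitting the whole class, so limit and infinite sum
need not be interchanged.

Exact symmetry at finite time: on inputs of length at least `n`, transforming commutes with
prefixing a string `x` (`inputTransform_emulated_mem_kClass`). By completeness and closure, `C` and
its transform have the same tree, hence the same path probabilities, and the same strings `x` lead
into the corresponding `k`-classes (`setProb_inputTransform`). The two sequences of class
probabilities coincide, started at `C` and at its transform; since the limit ignores the starting
point, the class probabilities agree. -/

/-! ### Stationary distributions from positive recurrence -/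

/-- A matrix of transition probabilities. -/
structure IsStochastic {S : Type*} (P : S → S → ℝ) : Prop where
  nonneg : ∀ i j, 0 ≤ P i j
  hasSum : ∀ i, HasSum (P i) 1

/-- A stationary probability distribution of the transition matrix `P`. -/
structure IsStationaryDistribution {S : Type*} (P : S → S → ℝ) (π : S → ℝ) : Prop where
  nonneg : ∀ i, 0 ≤ π i
  hasSum : HasSum π 1
  stationary : ∀ j, HasSum (fun i => π i * P i j) (π j)

theorem IsStochastic.summable_mul {S : Type*} {P : S → S → ℝ} (hP : IsStochastic P) (i : S)
    {u : S → ℝ} (hu : ∀ j, u j ∈ Set.Icc (0 : ℝ) 1) : Summable fun j => P i j * u j :=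
  Summable.of_nonneg_of_le (fun j => mul_nonneg (hP.nonneg i j) (hu j).1)
    (fun j => mul_le_of_le_one_right (hP.nonneg i j) (hu j).2) (hP.hasSum i).summable

theorem IsStochastic.tsum_mul_mem_Icc {S : Type*} {P : S → S → ℝ} (hP : IsStochastic P) (i : S)
    {u : S → ℝ} (hu : ∀ j, u j ∈ Set.Icc (0 : ℝ) 1) : ∑' j, P i j * u j ∈ Set.Icc (0 : ℝ) 1 := by
  refine ⟨tsum_nonneg fun j => mul_nonneg (hP.nonneg i j) (hu j).1, ?_⟩
  rw [← (hP.hasSum i).tsum_eq]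
  exact (hP.summable_mul i hu).tsum_le_tsum
    (fun j => mul_le_of_le_one_right (hP.nonneg i j) (hu j).2) (hP.hasSum i).summable

open Classical in
theorem firstPassageProb_add_two {S : Type*} (P : S → S → ℝ) (n : ℕ) (i j : S) :
    firstPassageProb P (n + 2) i j =
      ∑' k, P i k * (if k = j then 0 else firstPassageProb P (n + 1) k j) := by
  simp only [firstPassageProb]
  congr 1
  ext k
  split_ifs <;> simp

theorem IsStochastic.firstPassageProb_mem_Icc {S : Type*} {P : S → S → ℝ} (hP : IsStochastic P)
    (n : ℕ) (i j : S) : firstPassageProb P (n + 1) i j ∈ Set.Icc (0 : ℝ) 1 := by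
  induction n generalizing i with
  | zero =>
    simp only [firstPassageProb]
    exact ⟨hP.nonneg i j, le_hasSum (hP.hasSum i) j fun k _ => hP.nonneg i k⟩
  | succ n ih =>
    rw [firstPassageProb_add_two]
    refine hP.tsum_mul_mem_Icc i fun k => ?_
    split_ifs
    · simp
    · exact ih k

open Classical in
/-- The probability that the chain with transition matrix `p`, started at `j`, is at `k` at
time `n` without having returned to `j` at one of the times `1, …, n`. -/
noncomputable def tabooProb {S : Type*} (p : S → S → ENNReal) (j : S) : ℕ → S → ENNReal
  | 0, k => if k = j then 1 else 0
  | n + 1, k => if k = j then 0 else ∑' l, tabooProb p j n l * p l k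

-- Markov property at time `n` for first-return probabilities, where `F m l` stands for first
-- reaching `j` from `l` at time `m + 1`. Each induction step moves one transition from `tabooProb`
-- to `F`, so `m` must vary.
open Classical in
theorem tsum_tabooProb_mul {S : Type*} (p : S → S → ENNReal) (j : S) (F : ℕ → S → ENNReal)
    (hF : ∀ n i, F (n + 1) i = ∑' k, p i k * (if k = j then 0 else F n k)) (n m : ℕ) :
    ∑' l, tabooProb p j n l * F m l = F (n + m) j := by
  induction n generalizing m with
  | zero => simp [tabooProb]
  | succ n ih =>
    rw [show n + 1 + m = n + (m + 1) by ring, ← ih (m + 1)]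
    simp only [tabooProb, hF, ← ENNReal.tsum_mul_left]
    rw [ENNReal.tsum_comm]
    congr 1
    ext k
    split_ifs with h
    · simp
    · rw [← ENNReal.tsum_mul_right]
      exact tsum_congr fun l => by ring

-- Mass balance: what has not returned by time `n` either steps to `j` next or survives to time `n +
-- 1`.
open Classical in
theorem tsum_tabooProb {S : Type*} (p : S → S → ENNReal) (hp : ∀ i, ∑' j, p i j = 1) (j : S)
    (n : ℕ) : ∑' k, tabooProb p j n k =
      ∑' l, tabooProb p j n l * p l j + ∑' k, tabooProb p j (n + 1) k := by
  have h1 : ∑' k, tabooProb p j n k = ∑' k, ∑' l, tabooProb p j n l * p l k := by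
    rw [ENNReal.tsum_comm]
    simp [ENNReal.tsum_mul_left, hp]
  have h2 : ∀ k, ∑' l, tabooProb p j n l * p l k =
      (if k = j then ∑' l, tabooProb p j n l * p l j else 0) + tabooProb p j (n + 1) k := by
    intro k
    by_cases h : k = j
    · simp [tabooProb, h]
    · simp [tabooProb, h]
  rw [h1, tsum_congr h2, ENNReal.tsum_add, tsum_ite_eq]

/-- The term `f m` occurs in the tails from `n = 0, …, m`, hence the factor `m + 1`. This turns
summed survival probabilities into a mean return time. -/
theorem tsum_tail_eq (f : ℕ → ENNReal) :
    ∑' n, ∑' m, f (m + n) = ∑' n : ℕ, ((n : ENNReal) + 1) * f n := by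
  have h : ∀ n, ∑' m, f (m + n) = ∑' m, if n ≤ m then f m else 0 := by
    intro n
    rw [← Summable.sum_add_tsum_nat_add' (k := n) (f := fun m => if n ≤ m then f m else 0)
        ENNReal.summable,
      Finset.sum_eq_zero fun i hi => if_neg (by simpa using hi)]
    simp
  simp only [h]
  rw [ENNReal.tsum_comm]
  refine tsum_congr fun m => ?_
  rw [tsum_eq_sum (s := Finset.range (m + 1))]
  · rw [Finset.sum_congr rfl fun n hn => if_pos (by simpa [Nat.lt_succ_iff] using hn)]
    simp
  · intro n hn
    exact if_neg (by simpa [Nat.lt_succ_iff] using hn)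

-- The distribution is the normalized expected number of visits during one excursion from `j`,
-- counting time `0` but not the return. The total mass is the mean return time. Shifting an
-- excursion by one step replaces the visit to `j` at time `0` by the almost sure return, so the
-- measure is invariant.
open Classical in
theorem IsStochastic.exists_isStationaryDistribution {S : Type*} {P : S → S → ℝ} (hP : IsStochastic P)
    (hrec : IsPositiveRecurrentChain P) (j : S) : ∃ π, IsStationaryDistribution P π := by
  obtain ⟨hf1, hf2⟩ := hrec j
  set p : S → S → ENNReal := fun i k => ENNReal.ofReal (P i k) with hpdef
  have hp : ∀ i, ∑' k, p i k = 1 := fun i => by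
    rw [← ENNReal.ofReal_tsum_of_nonneg (hP.nonneg i) (hP.hasSum i).summable,
      (hP.hasSum i).tsum_eq, ENNReal.ofReal_one]
  -- Shifted by one, since a first passage takes at least one step and `firstPassageProb` is `0` at
  -- time `0`.
  set F : ℕ → S → ENNReal := fun n i => ENNReal.ofReal (firstPassageProb P (n + 1) i j)
  have hF : ∀ n i, F (n + 1) i = ∑' k, p i k * (if k = j then 0 else F n k) := by
    intro n i
    have hmem : ∀ k, (if k = j then 0 else firstPassageProb P (n + 1) k j) ∈ Set.Icc (0 : ℝ) 1 := by
      intro k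
      split_ifs
      · simp
      · exact hP.firstPassageProb_mem_Icc n k j
    simp only [F, firstPassageProb_add_two]
    rw [ENNReal.ofReal_tsum_of_nonneg (fun k => mul_nonneg (hP.nonneg i k) (hmem k).1)
      (hP.summable_mul i hmem)]
    refine tsum_congr fun k => ?_
    rw [ENNReal.ofReal_mul (hP.nonneg i k)]
    split_ifs <;> simp [hpdef]
  have hF0 : ∀ l, F 0 l = p l j := fun l => rfl
  have hFj : ∀ n, F n j = ∑' l, tabooProb p j n l * p l j := fun n => by
    simpa [hF0] using (tsum_tabooProb_mul p j F hF n 0).symm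
  have hf1' : HasSum (fun n : ℕ => firstPassageProb P (n + 1) j j) 1 := by
    rw [hasSum_nat_add_iff (f := fun n => firstPassageProb P n j j) 1]
    simpa [firstPassageProb] using hf1
  have hFsum : ∑' n, F n j = 1 := by
    rw [← ENNReal.ofReal_tsum_of_nonneg (fun n => (hP.firstPassageProb_mem_Icc n j j).1)
      hf1'.summable, hf1'.tsum_eq, ENNReal.ofReal_one]
  have hmean : ∑' n : ℕ, ((n : ENNReal) + 1) * F n j ≠ ⊤ := by
    have hs : Summable fun n : ℕ => ((n + 1 : ℕ) : ℝ) * firstPassageProb P (n + 1) j j :=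
      (summable_nat_add_iff 1).2 hf2
    have hnn : ∀ n : ℕ, 0 ≤ ((n + 1 : ℕ) : ℝ) * firstPassageProb P (n + 1) j j := fun n =>
      mul_nonneg (Nat.cast_nonneg _) (hP.firstPassageProb_mem_Icc n j j).1
    have := ENNReal.ofReal_tsum_of_nonneg hnn hs
    rw [tsum_congr fun n => ?_, ← this]
    · exact ENNReal.ofReal_ne_top
    · rw [ENNReal.ofReal_mul (Nat.cast_nonneg _), ENNReal.ofReal_natCast, Nat.cast_succ]
  have hG : ∀ n, ∑ m ∈ Finset.range n, F m j + ∑' k, tabooProb p j n k = 1 := by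
    intro n
    induction n with
    | zero => simp [tabooProb]
    | succ n ih => rw [Finset.sum_range_succ, hFj n, add_assoc, ← tsum_tabooProb p hp, ih]
  -- Recurrence enters here: no mass escapes forever, so survival to time `n` equals the probability
  -- of a later return.
  have hG' : ∀ n, ∑' k, tabooProb p j n k = ∑' m, F (m + n) j := by
    intro n
    have h1 := (hG n).trans
      (hFsum.symm.trans (Summable.sum_add_tsum_nat_add' (k := n) ENNReal.summable).symm)
    refine (ENNReal.add_right_inj ?_).1 h1
    exact ENNReal.sum_ne_top.2 fun m _ => ENNReal.ofReal_ne_top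
  set γ : S → ENNReal := fun k => ∑' n, tabooProb p j n k with hγ
  have htot : ∑' k, γ k ≠ ⊤ := by
    rw [hγ, ENNReal.tsum_comm]
    simp only [hG']
    rw [tsum_tail_eq fun n => F n j]
    exact hmean
  have hstat : ∀ k, ∑' l, γ l * p l k = γ k := by
    intro k
    simp only [hγ, ← ENNReal.tsum_mul_right]
    rw [ENNReal.tsum_comm, tsum_eq_zero_add' (f := fun n => tabooProb p j n k) ENNReal.summable]
    -- At `j` only time `0` contributes, so the right side is `1`, and the left side is the total
    -- return probability.
    by_cases hk : k = j
    · subst hk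
      simp [← hFj, hFsum, tabooProb]
    · simp [tabooProb, hk]
  have hγj : 1 ≤ γ j := by
    refine le_trans ?_ (ENNReal.le_tsum 0)
    simp [tabooProb]
  have htot0 : ∑' k, γ k ≠ 0 := fun h => by
    have := hγj.trans (ENNReal.le_tsum j)
    rw [h] at this
    simp at this
  have hγtop : ∀ k, γ k ≠ ⊤ := fun k => ENNReal.ne_top_of_tsum_ne_top htot k
  set c : ENNReal := ∑' k, γ k
  have hc : 0 < c.toReal := ENNReal.toReal_pos htot0 htot
  have hγs : HasSum (fun k => (γ k).toReal) c.toReal := by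
    rw [ENNReal.tsum_toReal_eq hγtop]
    exact (ENNReal.summable_toReal htot).hasSum
  refine ⟨fun k => (γ k).toReal / c.toReal, fun k => by positivity, ?_, fun k => ?_⟩
  · simpa [div_self hc.ne'] using hγs.div_const c.toReal
  · have h1 : HasSum (fun l => (γ l * p l k).toReal) (γ k).toReal := by
      have h2 : ∑' l, γ l * p l k ≠ ⊤ := by
        rw [hstat]
        exact hγtop k
      rw [← hstat k, ENNReal.tsum_toReal_eq fun l => ENNReal.ne_top_of_tsum_ne_top h2 l]
      exact (ENNReal.summable_toReal h2).hasSum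
    refine (h1.div_const c.toReal).congr_fun fun l => ?_
    simp [hpdef, ENNReal.toReal_ofReal (hP.nonneg l k)]
    ring

/-! ### Convergence to equilibrium by an `L²` argument -/

/-- Iterated application of the transition matrix `P` to the function `h`. -/
noncomputable def iterMatrix {S : Type*} (P : S → S → ℝ) (h : S → ℝ) : ℕ → S → ℝ
  | 0 => h
  | n + 1 => fun i => ∑' j, P i j * iterMatrix P h n j

/-- There is a path of length `n` from `i` to `j` along transitions of positive probability. -/
def Reaches {S : Type*} (P : S → S → ℝ) : ℕ → S → S → Prop
  | 0, i, j => i = j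
  | n + 1, i, j => ∃ k, 0 < P i k ∧ Reaches P n k j

section
variable {S : Type*} {P : S → S → ℝ} {π : S → ℝ}

theorem IsStochastic.iterMatrix_mem_Icc (hP : IsStochastic P) {h : S → ℝ}
    (hh : ∀ i, h i ∈ Set.Icc (0 : ℝ) 1) (n : ℕ) (i : S) :
    iterMatrix P h n i ∈ Set.Icc (0 : ℝ) 1 := by
  induction n generalizing i with
  | zero => exact hh i
  | succ n ih => exact hP.tsum_mul_mem_Icc i ih

theorem IsStationaryDistribution.summable_mul (hπ : IsStationaryDistribution P π) {u : S → ℝ}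
    (hu : ∀ j, u j ∈ Set.Icc (0 : ℝ) 1) : Summable fun i => π i * u i :=
  Summable.of_nonneg_of_le (fun i => mul_nonneg (hπ.nonneg i) (hu i).1)
    (fun i => mul_le_of_le_one_right (hπ.nonneg i) (hu i).2) hπ.hasSum.summable

theorem IsStationaryDistribution.tsum_mul_tsum (hπ : IsStationaryDistribution P π) (hP : IsStochastic P) {u : S → ℝ}
    (hu : ∀ j, u j ∈ Set.Icc (0 : ℝ) 1) :
    ∑' i, π i * ∑' j, P i j * u j = ∑' j, π j * u j := by
  have hs : Summable fun x : S × S => π x.1 * (P x.1 x.2 * u x.2) := by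
    rw [summable_prod_of_nonneg fun x =>
      mul_nonneg (hπ.nonneg _) (mul_nonneg (hP.nonneg _ _) (hu _).1)]
    refine ⟨fun i => (hP.summable_mul i hu).mul_left (π i), ?_⟩
    have h : ∀ i, ∑' j, π i * (P i j * u j) = π i * ∑' j, P i j * u j := fun i => tsum_mul_left
    simp only [h]
    exact hπ.summable_mul fun i => hP.tsum_mul_mem_Icc i hu
  simp only [← tsum_mul_left]
  have hcomm : ∑' i, ∑' j, π i * (P i j * u j) = ∑' j, ∑' i, π i * (P i j * u j) :=
    Summable.tsum_comm (f := fun j i => π i * (P i j * u j))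
      (hs.comp_injective Prod.swap_injective)
  rw [hcomm]
  refine tsum_congr fun j => ?_
  simp only [← mul_assoc]
  rw [tsum_mul_right, (hπ.stationary j).tsum_eq]

theorem sq_mem_Icc {x : ℝ} (hx : x ∈ Set.Icc (0 : ℝ) 1) : x ^ 2 ∈ Set.Icc (0 : ℝ) 1 :=
  ⟨sq_nonneg x, pow_le_one₀ hx.1 hx.2⟩

theorem IsStochastic.hasSum_variance (hP : IsStochastic P) (i : S) {u : S → ℝ}
    (hu : ∀ j, u j ∈ Set.Icc (0 : ℝ) 1) :
    HasSum (fun j => P i j * (u j - ∑' k, P i k * u k) ^ 2)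
      (∑' j, P i j * u j ^ 2 - (∑' j, P i j * u j) ^ 2) := by
  generalize hm : ∑' k, P i k * u k = m
  have h1 : HasSum (fun j => P i j * u j ^ 2) (∑' j, P i j * u j ^ 2) :=
    (hP.summable_mul i fun j => sq_mem_Icc (hu j)).hasSum
  have h2 : HasSum (fun j => P i j * u j) m :=
    hm ▸ (hP.summable_mul i hu).hasSum
  have h3 := (h1.sub (h2.mul_right (2 * m))).add ((hP.hasSum i).mul_right (m ^ 2))
  have e1 : (fun j => P i j * (u j - m) ^ 2) =
      fun j => P i j * u j ^ 2 - P i j * u j * (2 * m) + P i j * m ^ 2 := by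
    funext j
    ring
  have e2 : ∑' j, P i j * u j ^ 2 - m ^ 2 =
      ∑' j, P i j * u j ^ 2 - m * (2 * m) + 1 * m ^ 2 := by ring
  rw [e1, e2]
  exact h3

/-- By stationarity `u ^ 2` and its image under `P` have the same `π`-mean. Hence the loss of
squared `L²(π)` norm under `P` is the `π`-average of the one-step variances. -/
theorem IsStationaryDistribution.hasSum_variance (hπ : IsStationaryDistribution P π) (hP : IsStochastic P) {u : S → ℝ}
    (hu : ∀ j, u j ∈ Set.Icc (0 : ℝ) 1) :
    HasSum (fun i => π i * (∑' j, P i j * u j ^ 2 - (∑' j, P i j * u j) ^ 2))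
      (∑' i, π i * u i ^ 2 - ∑' i, π i * (∑' j, P i j * u j) ^ 2) := by
  have hu2 := fun j => sq_mem_Icc (hu j)
  rw [← hπ.tsum_mul_tsum hP hu2]
  have h1 := (hπ.summable_mul fun i => hP.tsum_mul_mem_Icc i hu2).hasSum
  have h2 := (hπ.summable_mul fun i => sq_mem_Icc (hP.tsum_mul_mem_Icc i hu)).hasSum
  simpa only [mul_sub] using h1.sub h2

theorem IsStochastic.variance_nonneg (hP : IsStochastic P) (i : S) {u : S → ℝ}
    (hu : ∀ j, u j ∈ Set.Icc (0 : ℝ) 1) : 0 ≤ ∑' j, P i j * u j ^ 2 - (∑' j, P i j * u j) ^ 2 :=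
  (hP.hasSum_variance i hu).nonneg fun j => mul_nonneg (hP.nonneg i j) (sq_nonneg _)

theorem IsStationaryDistribution.tsum_mul_sq_le (hπ : IsStationaryDistribution P π) (hP : IsStochastic P) {u : S → ℝ}
    (hu : ∀ j, u j ∈ Set.Icc (0 : ℝ) 1) :
    ∑' i, π i * (∑' j, P i j * u j) ^ 2 ≤ ∑' i, π i * u i ^ 2 :=
  sub_nonneg.1 <| (hπ.hasSum_variance hP hu).nonneg fun i =>
    mul_nonneg (hπ.nonneg i) (hP.variance_nonneg i hu)

/-- If no norm is lost, the one-step variance vanishes at every state charged by `π`, so `u` takes a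
single value on the successors of such a state. -/
theorem IsStationaryDistribution.eq_of_tsum_mul_sq_eq (hπ : IsStationaryDistribution P π) (hP : IsStochastic P)
    {u : S → ℝ} (hu : ∀ j, u j ∈ Set.Icc (0 : ℝ) 1)
    (heq : ∑' i, π i * (∑' j, P i j * u j) ^ 2 = ∑' i, π i * u i ^ 2) {i j : S} (hi : 0 < π i)
    (hij : 0 < P i j) : ∑' k, P i k * u k = u j := by
  have h1 := hπ.hasSum_variance hP hu
  rw [heq, sub_self, hasSum_zero_iff_of_nonneg fun i =>
    mul_nonneg (hπ.nonneg i) (hP.variance_nonneg i hu)] at h1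
  have h2 := hP.hasSum_variance i hu
  rw [(mul_eq_zero.1 (congrFun h1 i)).resolve_left hi.ne', hasSum_zero_iff_of_nonneg fun j =>
    mul_nonneg (hP.nonneg i j) (sq_nonneg _)] at h2
  have h3 := pow_eq_zero_iff (two_ne_zero) |>.1 ((mul_eq_zero.1 (congrFun h2 j)).resolve_left hij.ne')
  linarith

/-- Total mass one charges some state, and stationarity carries positive mass along transitions. -/
theorem IsStationaryDistribution.pos (hπ : IsStationaryDistribution P π) (hP : IsStochastic P)
    (hirr : ∀ i j, ∃ n, Reaches P n i j) (j : S) : 0 < π j := by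
  have hstep : ∀ n i, 0 < π i → Reaches P n i j → 0 < π j := by
    intro n
    induction n with
    | zero => rintro i hi rfl; exact hi
    | succ n ih =>
      rintro i hi ⟨k, hik, hk⟩
      refine ih k ?_ hk
      exact (mul_pos hi hik).trans_le
        (le_hasSum (hπ.stationary k) i fun l _ => mul_nonneg (hπ.nonneg l) (hP.nonneg l k))
  obtain ⟨i, hi⟩ : ∃ i, 0 < π i := by
    by_contra! h
    have h0 : π = 0 := funext fun i => le_antisymm (h i) (hπ.nonneg i)
    have := hπ.hasSum
    rw [h0] at this
    exact one_ne_zero (this.unique hasSum_zero)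
  obtain ⟨n, hn⟩ := hirr i j
  exact hstep n i hi hn

theorem IsStationaryDistribution.tsum_mul_iterMatrix (hπ : IsStationaryDistribution P π) (hP : IsStochastic P)
    {h : S → ℝ} (hh : ∀ i, h i ∈ Set.Icc (0 : ℝ) 1) (n : ℕ) :
    ∑' i, π i * iterMatrix P h n i = ∑' i, π i * h i := by
  induction n with
  | zero => rfl
  | succ n ih => rw [← ih]; exact hπ.tsum_mul_tsum hP (hP.iterMatrix_mem_Icc hh n)

theorem tendsto_tsum_mul_of_mem_Icc {α : Type*} {l : Filter α} {p : S → ℝ} (hp : ∀ i, 0 ≤ p i)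
    (hps : Summable p) {f : α → S → ℝ} (hf : ∀ a i, f a i ∈ Set.Icc (0 : ℝ) 1) {g : S → ℝ}
    (hfg : ∀ i, Tendsto (fun a => f a i) l (𝓝 (g i))) :
    Tendsto (fun a => ∑' i, p i * f a i) l (𝓝 (∑' i, p i * g i)) := by
  refine tendsto_tsum_of_dominated_convergence hps (fun i => (hfg i).const_mul (p i))
    (Eventually.of_forall fun a i => ?_)
  rw [Real.norm_of_nonneg (mul_nonneg (hp i) (hf a i).1)]
  exact mul_le_of_le_one_right (hp i) (hf a i).2

/-- A bounded solution of `w (k + 1) = P w k` that is constant along all transitions of positive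
probability is constant, if the chain is irreducible and aperiodic. -/
theorem eq_of_constant_along_transitions (hirr : ∀ i j, ∃ n, Reaches P n i j)
    (haper : ∀ i, ∀ d : ℕ, (∀ n, 1 ≤ n → Reaches P n i i → d ∣ n) → d = 1) {w : ℕ → S → ℝ}
    (hw : ∀ k i j, 0 < P i j → w (k + 1) i = w k j) (i j : S) : w 0 i = w 0 j := by
  have hreach : ∀ n k i j, Reaches P n i j → w (k + n) i = w k j := by
    intro n
    induction n with
    | zero => rintro k i j rfl; rfl
    | succ n ih =>
      rintro k i j ⟨l, hil, hl⟩
      rw [← add_assoc, hw _ i l hil, ih k l j hl]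
  have hconst : ∀ i k, w k i = w 0 i := by
    intro i
    -- Under the shift `T`, every return length to `i` is a period of `k ↦ w k i`. The minimal
    -- period divides them all, so aperiodicity makes it `1`.
    set T : (ℕ → ℝ) → (ℕ → ℝ) := fun v k => v (k + 1)
    have hT : ∀ n v, T^[n] v = fun k => v (k + n) := by
      intro n
      induction n with
      | zero => intro v; rfl
      | succ n ih =>
        intro v
        rw [Function.iterate_succ_apply, ih]
        funext k
        simp only [T, add_assoc]
    have h1 : Function.minimalPeriod T (fun k => w k i) = 1 := by
      refine haper i _ fun n _ hn => Function.IsPeriodicPt.minimalPeriod_dvd ?_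
      rw [Function.IsPeriodicPt, Function.IsFixedPt, hT]
      exact funext fun k => hreach n k i i hn
    have h2 : T (fun k => w k i) = fun k => w k i := Function.minimalPeriod_eq_one_iff_isFixedPt.1 h1
    intro k
    induction k with
    | zero => rfl
    | succ k ih => rw [← ih]; exact congrFun h2 k
  obtain ⟨n, hn⟩ := hirr i j
  rw [← hreach n 0 i j hn, hconst i (0 + n)]

/-- The convergence theorem for irreducible aperiodic Markov chains with a stationary
distribution. -/
theorem IsStationaryDistribution.tendsto_iterMatrix (hπ : IsStationaryDistribution P π) (hP : IsStochastic P)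
    (hirr : ∀ i j, ∃ n, Reaches P n i j)
    (haper : ∀ i, ∀ d : ℕ, (∀ n, 1 ≤ n → Reaches P n i i → d ∣ n) → d = 1)
    {h : S → ℝ} (hh : ∀ i, h i ∈ Set.Icc (0 : ℝ) 1) (i : S) :
    Tendsto (fun n => iterMatrix P h n i) atTop (𝓝 (∑' i, π i * h i)) := by
  -- An ultrafilter yields limits for all states and all time shifts at once, without a diagonal
  -- subsequence.
  rw [tendsto_iff_ultrafilter]
  intro U hU
  have hmem := hP.iterMatrix_mem_Icc hh
  have hex : ∀ (k : ℕ) (i : S), ∃ w ∈ Set.Icc (0 : ℝ) 1,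
      Tendsto (fun n => iterMatrix P h (n + k) i) U (𝓝 w) := fun k i =>
    isCompact_Icc.ultrafilter_le_nhds (U.map fun n => iterMatrix P h (n + k) i) <| by
      rw [le_principal_iff]
      exact Eventually.of_forall (f := (U : Filter ℕ)) fun n => hmem (n + k) i
  choose w hwmem hw using hex
  have hstep : ∀ k i, w (k + 1) i = ∑' j, P i j * w k j := fun k i =>
    tendsto_nhds_unique (hw (k + 1) i) <|
      tendsto_tsum_mul_of_mem_Icc (hP.nonneg i) (hP.hasSum i).summable
        (fun n : ℕ => hmem (n + k)) (hw k)
  -- The squared norms decrease, hence converge. All shifted limits `w k` therefore have the same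
  -- norm `c`, and passing from `w k` to `w (k + 1)` loses nothing.
  have hanti : Antitone fun n => ∑' i, π i * iterMatrix P h n i ^ 2 :=
    antitone_nat_of_succ_le fun n => hπ.tsum_mul_sq_le hP (hmem n)
  obtain ⟨c, hc⟩ : ∃ c, Tendsto (fun n => ∑' i, π i * iterMatrix P h n i ^ 2) atTop (𝓝 c) :=
    ⟨_, tendsto_atTop_ciInf hanti ⟨0, by
      rintro _ ⟨n, rfl⟩
      exact tsum_nonneg fun i => mul_nonneg (hπ.nonneg i) (sq_nonneg _)⟩⟩
  have hnorm : ∀ k, ∑' i, π i * w k i ^ 2 = c := fun k =>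
    tendsto_nhds_unique
      (tendsto_tsum_mul_of_mem_Icc hπ.nonneg hπ.hasSum.summable
        (fun (n : ℕ) i => sq_mem_Icc (hmem (n + k) i)) (fun i => (hw k i).pow 2))
      (((tendsto_add_atTop_iff_nat k).2 hc).mono_left hU)
  have hconst := eq_of_constant_along_transitions hirr haper (w := w) fun k i j hij => by
    rw [hstep]
    refine hπ.eq_of_tsum_mul_sq_eq hP (hwmem k) ?_ (hπ.pos hP hirr i) hij
    simp only [← hstep, hnorm]
  -- The `π`-mean is preserved by `P` and passes to the limit, which identifies the constant value
  -- of `w 0`.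
  have hmean : ∑' i, π i * w 0 i = ∑' i, π i * h i := by
    refine tendsto_nhds_unique (tendsto_tsum_mul_of_mem_Icc hπ.nonneg hπ.hasSum.summable
      (fun n : ℕ => hmem (n + 0)) (hw 0)) ?_
    simp only [hπ.tsum_mul_iterMatrix hP hh]
    exact tendsto_const_nhds
  have : ∑' i, π i * h i = w 0 i := by
    rw [← hmean, tsum_congr fun j => by rw [hconst j i], tsum_mul_right, hπ.hasSum.tsum_eq, one_mul]
  rw [this]
  exact hw 0 i
end
-- The emulation chain
namespace Computer

theorem emulated_append (C : Computer) (x y : List Bool) :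
    C.emulated (x ++ y) = (C.emulated x).emulated y :=
  Subtype.ext <| funext fun s => congrArg C.run (List.append_assoc x y s)

theorem emulated_nil (C : Computer) : C.emulated [] = C := rfl

theorem run_emulated (C : Computer) (x s : List Bool) : (C.emulated x).run s = C.run (x ++ s) := rfl

theorem emulated_cons (C : Computer) (b : Bool) (x : List Bool) :
    C.emulated (b :: x) = (C.emulated [b]).emulated x :=
  C.emulated_append [b] x

open Classical in
/-- The probability that the random walk on the `Φ`-tree of `C` chooses the bit `b` first. -/
noncomputable def bitProb (Φ : Set Computer) (C : Computer) (b : Bool) : ℝ :=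
  if C.emulated [!b] ∈ Φ then 1 / 2 else 1

theorem bitProb_pos (Φ : Set Computer) (C : Computer) (b : Bool) : 0 < bitProb Φ C b := by
  unfold bitProb
  split_ifs <;> norm_num

/-- The recursion for `pathProb` peels off the last bit, whereas one step of the chain consumes the
first. The induction from the end reconciles the two. -/
theorem pathProb_cons (Φ : Set Computer) (C : Computer) (b : Bool) (x : List Bool) :
    pathProb Φ C (b :: x) = bitProb Φ C b * pathProb Φ (C.emulated [b]) x := by
  classical
  induction x using List.reverseRecOn with
  | nil =>
    rw [← List.nil_append [b], pathProb_concat]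
    simp only [pathProb_nil, bitProb, mul_one]
    exact if_congr Iff.rfl rfl rfl
  | append_singleton x c ih =>
    rw [← List.cons_append, pathProb_concat, pathProb_concat, ih]
    have h : b :: x ++ [!c] ∈ tree Φ C ↔ x ++ [!c] ∈ tree Φ (C.emulated [b]) := by
      simp only [tree, Set.mem_ofPred_eq]
      rw [List.cons_append, emulated_cons]
    rw [if_congr h rfl rfl]
    split_ifs <;> ring

theorem pathProb_congr {Φ : Set Computer} {C D : Computer} (h : tree Φ C = tree Φ D)
    (x : List Bool) : pathProb Φ C x = pathProb Φ D x := by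
  induction x using List.reverseRecOn with
  | nil => rfl
  | append_singleton x b ih => rw [pathProb_concat, pathProb_concat, ih, h]

open Classical in
/-- The probability that `C` emulates an element of `A` after reading `n` random bits. -/
noncomputable def setProb (Φ : Set Computer) (C : Computer) (n : ℕ) (A : Set Computer) : ℝ :=
  ∑ x : Fin n → Bool, if C.emulated (List.ofFn x) ∈ A then pathProb Φ C (List.ofFn x) else 0

theorem nStepProb_eq_setProb (Φ : Set Computer) (C : Computer) (n : ℕ) (D : Computer) :
    nStepProb Φ C n D = setProb Φ C n {D} := by
  classical
  exact Finset.sum_congr rfl fun x _ => if_congr (emulates_iff _ _ _) rfl rfl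

theorem setProb_succ (Φ : Set Computer) (C : Computer) (n : ℕ) (A : Set Computer) :
    setProb Φ C (n + 1) A = ∑ b, bitProb Φ C b * setProb Φ (C.emulated [b]) n A := by
  simp only [setProb, Finset.mul_sum]
  rw [← (Fin.consEquiv fun _ : Fin (n + 1) => Bool).sum_comp, Fintype.sum_prod_type]
  refine Finset.sum_congr rfl fun b _ => Finset.sum_congr rfl fun x _ => ?_
  have hx : List.ofFn (Fin.consEquiv (fun _ : Fin (n + 1) => Bool) (b, x)) = b :: List.ofFn x := by
    simp [Fin.consEquiv, List.ofFn_succ]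
  rw [hx, emulated_cons C b, pathProb_cons, mul_ite, mul_zero]

theorem setProb_zero (Φ : Set Computer) (C : Computer) (A : Set Computer) :
    setProb Φ C 0 A = A.indicator 1 C := by
  classical
  rw [setProb, Fintype.sum_unique, List.ofFn_zero, emulated_nil, pathProb_nil, Set.indicator]
  exact if_congr Iff.rfl rfl rfl

theorem emulated_singleton_mem {Φ : Set Computer} (hΦ : IsBranching Φ) {C : Computer} (hC : C ∈ Φ)
    {b : Bool} {x : List Bool} (hx : C.emulated (b :: x) ∈ Φ) : C.emulated [b] ∈ Φ :=
  (hΦ C hC).1 [b] x hx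

/-- The tree is closed under prefixes, so a string that leaves it never comes back. This discards
the out-of-tree bit in `setProb_succ`, which the emulation matrix does not see. -/
theorem setProb_eq_zero {Φ : Set Computer} (hΦ : IsBranching Φ) {C : Computer} (hC : C ∈ Φ)
    {b : Bool} (hb : C.emulated [b] ∉ Φ) (n : ℕ) {A : Set Computer} (hA : A ⊆ Φ) :
    setProb Φ (C.emulated [b]) n A = 0 :=
  Finset.sum_eq_zero fun _ _ => if_neg fun hx =>
    hb (emulated_singleton_mem hΦ hC (by rw [emulated_cons]; exact hA hx))

open Classical in
theorem emulationMatrix_apply (Φ : Set Computer) (C D : Φ) :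
    emulationMatrix Φ C D = ∑ b, if C.1.emulated [b] = D.1 then bitProb Φ C b else 0 := by
  rw [emulationMatrix, nStepProb_eq_setProb, setProb_succ]
  refine Finset.sum_congr rfl fun b _ => ?_
  simp [setProb_zero, Set.indicator]

open Classical in
theorem hasSum_emulationMatrix_mul {Φ : Set Computer} (C : Φ) (v : Computer → ℝ) :
    HasSum (fun D : Φ => emulationMatrix Φ C D * v D)
      (∑ b, if C.1.emulated [b] ∈ Φ then bitProb Φ C b * v (C.1.emulated [b]) else 0) := by
  simp only [emulationMatrix_apply, Finset.sum_mul]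
  refine hasSum_sum fun b _ => ?_
  split_ifs with h
  · convert hasSum_single (f := fun D : Φ =>
      (if C.1.emulated [b] = D.1 then bitProb Φ C b else 0) * v D) ⟨_, h⟩ ?_ using 1
    · simp
    · intro D hD
      rw [if_neg fun h' => hD (Subtype.ext h'.symm), zero_mul]
  · convert hasSum_zero using 1
    funext D
    rw [if_neg fun h' : C.1.emulated [b] = D.1 => h (h' ▸ D.2), zero_mul]

theorem isStochastic_emulationMatrix {Φ : Set Computer} (hΦ : IsBranching Φ) :
    IsStochastic (emulationMatrix Φ) where
  nonneg C D := by
    rw [emulationMatrix_apply]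
    refine Finset.sum_nonneg fun b _ => ?_
    split_ifs
    · exact (bitProb_pos Φ C b).le
    · exact le_rfl
  hasSum C := by
    convert hasSum_emulationMatrix_mul C fun _ => 1 using 1
    · simp
    -- Branching puts at least one bit in the tree: two such bits have weight `1 / 2` each, a single
    -- one has weight `1`.
    · obtain ⟨x, hx0, hx⟩ := (hΦ C C.2).2
      obtain ⟨b, y, rfl⟩ := List.exists_cons_of_ne_nil hx0
      have hb := emulated_singleton_mem hΦ C.2 hx
      cases b <;> by_cases h : C.1.emulated [!false] ∈ Φ <;>
        by_cases h' : C.1.emulated [!true] ∈ Φ <;> simp_all [bitProb] <;> norm_num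

theorem iterMatrix_emulationMatrix {Φ : Set Computer} (hΦ : IsBranching Φ) {A : Set Computer}
    (hA : A ⊆ Φ) (n : ℕ) (C : Φ) :
    iterMatrix (emulationMatrix Φ) (fun D => A.indicator 1 D.1) n C = setProb Φ C n A := by
  induction n generalizing C with
  | zero => simp only [iterMatrix, setProb_zero]
  | succ n ih =>
    simp only [iterMatrix, ih, setProb_succ]
    rw [(hasSum_emulationMatrix_mul C fun D => setProb Φ D n A).tsum_eq]
    refine Finset.sum_congr rfl fun b _ => ?_
    split_ifs with h
    · rfl
    · rw [setProb_eq_zero hΦ C.2 h n hA, mul_zero]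

theorem reaches_of_emulates {Φ : Set Computer} (hΦ : IsBranching Φ) (C D : Φ) {x : List Bool}
    (hx : C.1.Emulates x D) : Reaches (emulationMatrix Φ) x.length C D := by
  induction x generalizing C with
  | nil => exact Subtype.ext ((emulates_iff _ _ _).1 hx)
  | cons b x ih =>
    have hx' := (emulates_iff _ _ _).1 hx
    have hb := emulated_singleton_mem hΦ C.2 (hx' ▸ D.2 : C.1.emulated (b :: x) ∈ Φ)
    refine ⟨⟨_, hb⟩, ?_, ih _ ?_⟩
    · rw [emulationMatrix_apply]
      refine Finset.sum_pos' (fun c _ => ?_) ⟨b, Finset.mem_univ b, ?_⟩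
      · split_ifs
        · exact (bitProb_pos Φ C c).le
        · exact le_rfl
      · simpa using bitProb_pos Φ C b
    · rw [emulates_iff, ← emulated_cons, hx']

theorem exists_emulates_of_nStepProb_pos {Φ : Set Computer} {C D : Computer} {n : ℕ}
    (h : 0 < nStepProb Φ C n D) : ∃ x : List Bool, x.length = n ∧ C.Emulates x D := by
  obtain ⟨x, _, hx⟩ := Finset.exists_ne_zero_of_sum_ne_zero h.ne'
  exact ⟨List.ofFn x, List.length_ofFn, by by_contra h'; exact hx (if_neg h')⟩

theorem IsPositiveRecurrent.reaches {Φ : Set Computer} (hΦ : IsPositiveRecurrent Φ) (C D : Φ) :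
    ∃ n, Reaches (emulationMatrix Φ) n C D :=
  let ⟨x, hx⟩ := hΦ.irreducible C C.2 D D.2
  ⟨x.length, reaches_of_emulates hΦ.branching C D hx⟩

/-- A positive `n`-step probability comes from an emulating string of length `n`, so a common
divisor of the path lengths also divides these `n`. -/
theorem IsPositiveRecurrent.reaches_aperiodic {Φ : Set Computer} (hΦ : IsPositiveRecurrent Φ)
    (C : Φ) (d : ℕ) (hd : ∀ n, 1 ≤ n → Reaches (emulationMatrix Φ) n C C → d ∣ n) : d = 1 := by
  refine hΦ.aperiodic C C.2 d fun n hn hpos => hd n hn ?_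
  obtain ⟨x, rfl, hx⟩ := exists_emulates_of_nStepProb_pos hpos
  exact reaches_of_emulates hΦ.branching C C hx

theorem indicator_one_mem_Icc {Φ : Set Computer} (A : Set Computer) (D : Φ) :
    A.indicator (1 : Computer → ℝ) D.1 ∈ Set.Icc (0 : ℝ) 1 := by
  by_cases h : D.1 ∈ A <;> simp [h]

theorem IsPositiveRecurrent.tendsto_setProb {Φ : Set Computer} (hΦ : IsPositiveRecurrent Φ)
    {π : Φ → ℝ} (hπ : IsStationaryDistribution (emulationMatrix Φ) π) {A : Set Computer}
    (hA : A ⊆ Φ) {X : Computer} (hX : X ∈ Φ) :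
    Tendsto (fun n => setProb Φ X n A) atTop (𝓝 (∑' D : Φ, π D * A.indicator 1 D.1)) := by
  simpa only [iterMatrix_emulationMatrix hΦ.branching hA] using
    hπ.tendsto_iterMatrix (isStochastic_emulationMatrix hΦ.branching) hΦ.reaches
      hΦ.reaches_aperiodic (indicator_one_mem_Icc A) ⟨X, hX⟩

theorem IsPositiveRecurrent.tendsto_nStepProb {Φ : Set Computer} (hΦ : IsPositiveRecurrent Φ)
    {π : Φ → ℝ} (hπ : IsStationaryDistribution (emulationMatrix Φ) π) (D : Φ) {X : Computer}
    (hX : X ∈ Φ) : Tendsto (fun n => nStepProb Φ X n D) atTop (𝓝 (π D)) := by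
  simp only [nStepProb_eq_setProb]
  have h := hΦ.tendsto_setProb hπ (Set.singleton_subset_iff.2 D.2) hX
  rw [tsum_eq_single D] at h
  · simpa using h
  · intro E hE
    simp [Subtype.coe_inj, hE]

theorem IsPositiveRecurrent.computerProb_eq {Φ : Set Computer} (hΦ : IsPositiveRecurrent Φ)
    {π : Φ → ℝ} (hπ : IsStationaryDistribution (emulationMatrix Φ) π) (D : Φ) :
    computerProb Φ D = π D := by
  have h : ∃ p : ℝ, ∀ C ∈ Φ, Tendsto (fun n : ℕ => nStepProb Φ C n D) atTop (𝓝 p) :=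
    ⟨π D, fun C hC => hΦ.tendsto_nStepProb hπ D hC⟩
  rw [computerProb, dif_pos h]
  exact tendsto_nhds_unique (h.choose_spec D D.2) (hΦ.tendsto_nStepProb hπ D D.2)

theorem IsPositiveRecurrent.hasSum_computerProb {Φ : Set Computer} (hΦ : IsPositiveRecurrent Φ)
    {π : Φ → ℝ} (hπ : IsStationaryDistribution (emulationMatrix Φ) π) {A : Set Computer}
    (hA : A ⊆ Φ) :
    HasSum (fun D : A => computerProb Φ D) (∑' D : Φ, π D * A.indicator 1 D.1) := by
  -- The sum over `A` is the sum over `Φ` of the values extended by zero off `A`.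
  have h := (hπ.summable_mul (indicator_one_mem_Icc A)).hasSum
  have hinj : Function.Injective (Set.inclusion hA) := Set.inclusion_injective hA
  rw [← hinj.hasSum_iff] at h
  · convert h using 1
    funext D
    simp [← hΦ.computerProb_eq hπ]
  · intro D hD
    have : D.1 ∉ A := fun h' => hD ⟨⟨D.1, h'⟩, rfl⟩
    simp [this]

/-! ### Input transformations -/

theorem kClass_mono {k l : ℕ} (h : k ≤ l) (C : Computer) : kClass k C ⊆ kClass l C :=
  fun _ hD x hx => hD x (h.trans hx)

theorem IsCompleteSet.mem_iff {Φ : Set Computer} (hΦ : IsCompleteSet Φ) {k : ℕ} (hk : 1 ≤ k)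
    {C D : Computer} (h : D ∈ kClass k C) : D ∈ Φ ↔ C ∈ Φ :=
  ⟨fun hD => hΦ D hD k hk ((kSetoid k).symm' h), fun hC => hΦ C hC k hk h⟩

end Computer

theorem lastBits_ofFn_append {n : ℕ} (s : List Bool) (hs : n ≤ s.length) :
    s.take (s.length - n) ++ List.ofFn (lastBits n s) = s := by
  refine List.ext_getElem (by simp [hs]) fun i h1 h2 => ?_
  rw [List.getElem_append]
  split_ifs with h
  · simp
  · simp only [List.length_take, not_lt] at h
    have : s.length - n + (i - min (s.length - n) s.length) = i := by omega
    simp only [List.getElem_ofFn, lastBits, List.length_take, this]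
    exact List.getD_eq_getElem s false h2

theorem exists_append_ofFn {n : ℕ} {s : List Bool} (hs : n ≤ s.length) :
    ∃ (t : List Bool) (x : Fin n → Bool), s = t ++ List.ofFn x :=
  ⟨_, _, (lastBits_ofFn_append s hs).symm⟩

theorem length_permuteLast {n : ℕ} (σ : Equiv.Perm (Fin n → Bool)) (s : List Bool) :
    (permuteLast σ s).length = s.length := by
  rcases lt_or_ge s.length n with hs | hs
  · rw [permuteLast_of_lt σ s hs]
  · obtain ⟨t, x, rfl⟩ := exists_append_ofFn hs
    simp [permuteLast_append]

theorem permuteLast_append_left {n : ℕ} (σ : Equiv.Perm (Fin n → Bool)) (x s : List Bool)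
    (hs : n ≤ s.length) : permuteLast σ (x ++ s) = x ++ permuteLast σ s := by
  obtain ⟨t, y, rfl⟩ := exists_append_ofFn hs
  rw [← List.append_assoc, permuteLast_append, permuteLast_append, List.append_assoc]

theorem permuteLast_mul {n : ℕ} (σ τ : Equiv.Perm (Fin n → Bool)) (s : List Bool) :
    permuteLast (σ * τ) s = permuteLast σ (permuteLast τ s) := by
  rcases lt_or_ge s.length n with hs | hs
  · simp [permuteLast_of_lt _ s hs]
  · obtain ⟨t, x, rfl⟩ := exists_append_ofFn hs
    simp [permuteLast_append]

theorem permuteLast_one {n : ℕ} (s : List Bool) :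
    permuteLast (1 : Equiv.Perm (Fin n → Bool)) s = s := by
  rcases lt_or_ge s.length n with hs | hs
  · exact permuteLast_of_lt _ s hs
  · obtain ⟨t, x, rfl⟩ := exists_append_ofFn hs
    simp [permuteLast_append]

namespace Computer

variable {n : ℕ} (σ : Equiv.Perm (Fin n → Bool))

theorem run_inputTransform (C : Computer) (s : List Bool) :
    (inputTransform σ C).run s = C.run (permuteLast σ s) := rfl

theorem inputTransform_mul (τ : Equiv.Perm (Fin n → Bool)) (C : Computer) :
    inputTransform (σ * τ) C = inputTransform τ (inputTransform σ C) :=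
  Subtype.ext <| funext fun s => congrArg C.run (permuteLast_mul σ τ s)

theorem inputTransform_one (C : Computer) :
    inputTransform (1 : Equiv.Perm (Fin n → Bool)) C = C :=
  Subtype.ext <| funext fun s => congrArg C.run (permuteLast_one s)

theorem inputTransform_mem_kClass {C D : Computer} {k : ℕ} (h : D ∈ kClass k C) :
    inputTransform σ D ∈ kClass k (inputTransform σ C) :=
  fun x hx => h (permuteLast σ x) (by rwa [length_permuteLast])

theorem inputTransform_mem_kClass_iff {C D : Computer} {k : ℕ} :
    inputTransform σ D ∈ kClass k (inputTransform σ C) ↔ D ∈ kClass k C := by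
  refine ⟨fun h => ?_, inputTransform_mem_kClass σ⟩
  have := inputTransform_mem_kClass σ⁻¹ h
  rwa [← inputTransform_mul, ← inputTransform_mul, mul_inv_cancel, inputTransform_one,
    inputTransform_one] at this

/-- For inputs of length at least `n` the permuted bits lie beyond `x`. Shorter inputs would let `σ`
reach into `x`, so in general only `n`-equivalence can be expected. This is where `k ≥ n` comes
from. -/
theorem inputTransform_emulated_mem_kClass (C : Computer) (x : List Bool) :
    inputTransform σ (C.emulated x) ∈ kClass n ((inputTransform σ C).emulated x) := by
  intro s hs
  simp only [run_emulated, run_inputTransform, permuteLast_append_left σ x s hs]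

variable {σ}

/-- Closure gives one direction. For the other, `σ` has finite order, so its inverse is a power of
`σ`. -/
theorem IsClosedUnder.inputTransform_mem_iff {Φ : Set Computer}
    (hΦ : IsClosedUnder Φ (inputTransform σ)) {C : Computer} :
    inputTransform σ C ∈ Φ ↔ C ∈ Φ := by
  have hfwd : ∀ D ∈ Φ, inputTransform σ D ∈ Φ := fun D hD => hΦ ⟨D, hD, rfl⟩
  have hpow : ∀ m : ℕ, ∀ D ∈ Φ, inputTransform (σ ^ m) D ∈ Φ := by
    intro m
    induction m with
    | zero => intro D hD; rwa [pow_zero, inputTransform_one]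
    | succ m ih => intro D hD; rw [pow_succ, inputTransform_mul]; exact hfwd _ (ih D hD)
  refine ⟨fun h => ?_, hfwd C⟩
  have hpos : 0 < orderOf σ := orderOf_pos σ
  have := hpow (orderOf σ - 1) _ h
  rwa [← inputTransform_mul, mul_pow_sub_one hpos.ne', pow_orderOf_eq_one, inputTransform_one]
    at this

/-- Completeness makes membership in `Φ` insensitive to `n`-equivalence, so the commutation up to
`n`-equivalence suffices. -/
theorem tree_inputTransform {Φ : Set Computer} (hcomplete : IsCompleteSet Φ) (hn : 0 < n)
    (hΦ : IsClosedUnder Φ (inputTransform σ)) (C : Computer) :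
    tree Φ (inputTransform σ C) = tree Φ C := by
  ext x
  simp only [tree, Set.mem_ofPred_eq]
  rw [← hcomplete.mem_iff hn (inputTransform_emulated_mem_kClass σ C x), hΦ.inputTransform_mem_iff]

theorem emulated_inputTransform_mem_kClass_iff {k : ℕ} (hk : n ≤ k) (C X : Computer)
    (x : List Bool) : (inputTransform σ X).emulated x ∈ kClass k (inputTransform σ C) ↔
      X.emulated x ∈ kClass k C := by
  rw [← inputTransform_mem_kClass_iff σ (D := X.emulated x)]
  have h := kClass_mono hk _ (inputTransform_emulated_mem_kClass σ X x)
  exact ⟨fun h' => (kSetoid k).trans' h' h, fun h' => (kSetoid k).trans' h' ((kSetoid k).symm' h)⟩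

/-- The sums agree term by term: the same strings contribute, with the same weights. -/
theorem setProb_inputTransform {Φ : Set Computer} (hcomplete : IsCompleteSet Φ) (hn : 0 < n)
    (hΦ : IsClosedUnder Φ (inputTransform σ)) {k : ℕ} (hk : n ≤ k) (C X : Computer) (m : ℕ) :
    setProb Φ (inputTransform σ X) m (kClass k (inputTransform σ C)) =
      setProb Φ X m (kClass k C) := by
  classical
  exact Finset.sum_congr rfl fun x _ =>
    if_congr (emulated_inputTransform_mem_kClass_iff hk C X _)
      (pathProb_congr (tree_inputTransform hcomplete hn hΦ X) _) rfl

end Computer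

theorem mainTheorem8 (Φ : Set Computer) (hpos : IsPositiveRecurrent Φ) (hcomplete : IsCompleteSet Φ)
    (n : ℕ) (σ : Equiv.Perm (Fin n → Bool)) (hσ : MovesFirstBit σ)
    (hclosed : IsClosedUnder Φ (inputTransform σ))
    (k : ℕ) (hk : n ≤ k) (C : Computer) (hC : C ∈ Φ) :
    (∀ D ∈ Φ, ∀ X ∈ Φ,
      Tendsto (fun m : ℕ => nStepProb Φ X m D) atTop (𝓝 (computerProb Φ D))) ∧
    Summable (fun D : kClass k C => computerProb Φ D) ∧
    Summable (fun D : kClass k (inputTransform σ C) => computerProb Φ D) ∧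
    classProb Φ k C = classProb Φ k (inputTransform σ C) := by
  obtain ⟨hn, -⟩ := hσ
  obtain ⟨π, hπ⟩ := (isStochastic_emulationMatrix hpos.branching).exists_isStationaryDistribution
    hpos.recurrent ⟨C, hC⟩
  have hIC : inputTransform σ C ∈ Φ := hclosed.inputTransform_mem_iff.2 hC
  have hA := hcomplete C hC k (Nat.one_le_iff_ne_zero.2 (by omega))
  have hB := hcomplete _ hIC k (Nat.one_le_iff_ne_zero.2 (by omega))
  have hsA := hpos.hasSum_computerProb hπ hA
  have hsB := hpos.hasSum_computerProb hπ hB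
  refine ⟨fun D hD X hX => ?_, hsA.summable, hsB.summable, ?_⟩
  · rw [hpos.computerProb_eq hπ ⟨D, hD⟩]
    exact hpos.tendsto_nStepProb hπ ⟨D, hD⟩ hX
  · rw [classProb, classProb, hsA.tsum_eq, hsB.tsum_eq]
    -- The walks start at `C` and at its transform respectively. Their class probabilities agree at
    -- every time, and each limit is independent of the starting point.
    refine tendsto_nhds_unique (hpos.tendsto_setProb hπ hA hC) ?_
    simpa only [setProb_inputTransform hcomplete hn hclosed hk] using
      hpos.tendsto_setProb hπ hB hIC
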